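/- Let $G=(V,E)$ be a finite directed graph that is cycle-disjoint, i.e. every node lies on at most one directed cycle of $G$. Let $\mathbb R^E$ be the set of real $V\times V$ matrices $\Lambda=(\lambda_{ij})$ such that $I-\Lambda$ is invertible and $\lambda_{ij}=0$ whenever $i\to j\notin E$. For $\Lambda\in\mathbb R^E$ and a random vector $\varepsilon=(\varepsilon_i)_{i\in V}$ with independent, centered components having positive variances and finite third absolute moments, put $X=(I-\Lambda)^{-\mathrm T}\varepsilon$ (the unique solution of $X=\Lambda^{\mathrm T}X+\varepsilon$), $s_{ij}=\mathbb E[X_iX_j]$, $t_{ijk}=\mathbb E[X_iX_jX_k]$, and for $u,v\in V$ $$d_{uv}^{2\times2}=\det\begin{pmatrix}s_{uu}&s_{uv}\\ t_{uuu}&t_{uuv}\end{pmatrix},\qquad d_{uv}^{3\times3}=\det\begin{pmatrix}s_{uu}&s_{uv}&s_{vv}\\ t_{uuu}&t_{uuv}&t_{uvv}\\ t_{uuv}&t_{uvv}&t_{vvv}\end{pmatrix}.$$ Such a determinant is said to vanish identically if it is $0$ for every choice of $\Lambda\in\mathbb R^E$ and of the distribution of $\varepsilon$ as above. A set $C\subseteq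 V$ is ancestral if every node with a directed path (of length $\ge 0$) to a node of $C$ belongs to $C$; a root cycle is the vertex set of a directed cycle of $G$ that is ancestral. Let $\mathcal C$ be the collection of all inclusion-maximal sets $C\subseteq V$ such that, for all distinct $u,v\in C$, $d_{uv}^{3\times3}$ vanishes identically but $d_{uv}^{2\times2}$ does not vanish identically. Then $\mathcal C$ contains every root cycle of $G$. -/

import Mathlib

open MeasureTheory ProbabilityTheory

namespace LSEM

/-! ### Directed graphs, cycles, ancestors -/

section Graph

variable {V : Type*}

/-- A directed cycle `v₁ → v₂ → ⋯ → vₙ → v₁` of `G` with `n ≥ 1` distinct vertices, taken up to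
rotation (`Cycle V` is the type of lists up to rotation). -/
def IsDirectedCycle (G : Digraph V) (c : Cycle V) : Prop :=
  c ≠ Cycle.nil ∧ c.Nodup ∧ c.Chain G.Adj

/-- Each node of `G` belongs to at most one directed cycle of `G`. -/
def CycleDisjoint (G : Digraph V) : Prop :=
  ∀ (v : V) (c c' : Cycle V), IsDirectedCycle G c → IsDirectedCycle G c' →
    v ∈ c → v ∈ c' → c = c'

/-- Nodes with a directed path, of length at least `0`, to some node of `C`. -/
def ancestors (G : Digraph V) (C : Set V) : Set V :=
  {u | ∃ v ∈ C, Relation.ReflTransGen G.Adj u v}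

def IsAncestral (G : Digraph V) (C : Set V) : Prop :=
  ancestors G C = C

/-- `C` is the vertex set of a directed cycle of `G`, and is ancestral. -/
def IsRootCycle (G : Digraph V) (C : Set V) : Prop :=
  (∃ c : Cycle V, IsDirectedCycle G c ∧ C = {v | v ∈ c}) ∧ IsAncestral G C

end Graph

/-! ### The linear structural equation model and its moments -/

noncomputable section Model

variable {V : Type*} [Fintype V] [DecidableEq V]

/-- The coefficient matrices `Λ` supported on the edges of `G` with `I - Λ` invertible. -/
def coefficientMatrices (G : Digraph V) : Set (Matrix V V ℝ) :=
  {Λ | IsUnit (1 - Λ) ∧ ∀ i j, ¬ G.Adj i j → Λ i j = 0}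

/-- `μ` is the joint law of a noise vector `ε` with independent, centered components of positive
variance and with finite third moments. -/
structure IsNoiseLaw {V : Type*} (μ : Measure (V → ℝ)) : Prop where
  isProbabilityMeasure : IsProbabilityMeasure μ
  indep : iIndepFun (fun (i : V) (ε : V → ℝ) => ε i) μ
  memLp : ∀ i, MemLp (fun ε : V → ℝ => ε i) 3 μ
  centered : ∀ i, ∫ ε, ε i ∂μ = 0
  variance_pos : ∀ i, 0 < ∫ ε, ε i ^ 2 ∂μ

/-- `X = (I - Λ)⁻ᵀ ε`, the solution of `X = Λᵀ X + ε`. -/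
def solution (Λ : Matrix V V ℝ) (ε : V → ℝ) : V → ℝ :=
  Matrix.mulVec ((1 - Λ)⁻¹).transpose ε

/-- `s_ij = E[X_i X_j]`. -/
def secondMoment (Λ : Matrix V V ℝ) (μ : Measure (V → ℝ)) (i j : V) : ℝ :=
  ∫ ε, solution Λ ε i * solution Λ ε j ∂μ

/-- `t_ijk = E[X_i X_j X_k]`. -/
def thirdMoment (Λ : Matrix V V ℝ) (μ : Measure (V → ℝ)) (i j k : V) : ℝ :=
  ∫ ε, solution Λ ε i * solution Λ ε j * solution Λ ε k ∂μ

/-- The determinant `d_uv^{2×2}`. -/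
def det2 (u v : V) (Λ : Matrix V V ℝ) (μ : Measure (V → ℝ)) : ℝ :=
  Matrix.det !![secondMoment Λ μ u u, secondMoment Λ μ u v;
                thirdMoment Λ μ u u u, thirdMoment Λ μ u u v]

/-- The determinant `d_uv^{3×3}`. -/
def det3 (u v : V) (Λ : Matrix V V ℝ) (μ : Measure (V → ℝ)) : ℝ :=
  Matrix.det !![secondMoment Λ μ u u, secondMoment Λ μ u v, secondMoment Λ μ v v;
                thirdMoment Λ μ u u u, thirdMoment Λ μ u u v, thirdMoment Λ μ u v v;
                thirdMoment Λ μ u u v, thirdMoment Λ μ u v v, thirdMoment Λ μ v v v]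

/-- A function of the model parameters vanishes identically on the model of `G`: it is zero for
every choice of coefficient matrix and of noise distribution. -/
def VanishesIdentically (G : Digraph V) (d : Matrix V V ℝ → Measure (V → ℝ) → ℝ) : Prop :=
  ∀ Λ ∈ coefficientMatrices G, ∀ μ : Measure (V → ℝ), IsNoiseLaw μ → d Λ μ = 0

/-- The inclusion-maximal sets `C` of nodes such that for all distinct `u, v ∈ C` the determinant
`d_uv^{3×3}` vanishes identically but `d_uv^{2×2}` does not. (For `u = v` the latter always
vanishes, so the condition concerns distinct nodes.) -/
def candidateCycles (G : Digraph V) : Set (Set V) :=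
  {C | Maximal (fun D : Set V => ∀ u ∈ D, ∀ v ∈ D, u ≠ v →
    VanishesIdentically G (det3 u v) ∧ ¬ VanishesIdentically G (det2 u v)) C}

end Model

end LSEM

/-! Put `B = (I - Λ)⁻¹`. By independence and centering, `s_uv` and `t_uvw` are sums over sources `i`
of products of entries of row `i` of `B`, weighted by the moments of `ε i`. In a root cycle of a
cycle-disjoint graph every node has a single parent, its predecessor. Hence, for distinct `u, v` on
it, columns `u` and `v` of `B` are proportional by `β` off the arc `(u, v]` and by `α` off the arc
`(v, u]`. These arcs are disjoint, so `(b_v - β b_u)(b_u - α b_v) = 0` in every row, which is a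
linear relation between the columns of the `3×3` matrix (`det3_eq_zero`). A tree model rooted at `v`
shows that the `2×2` determinant is not identically zero. For maximality, let `w` lie outside the
cycle. If the cycle does not reach `w`, no node is an ancestor of both, and `det2` vanishes.
Otherwise let `e` be the node where a path to `w` leaves the cycle. If `e` is alone on the cycle, it
is its own only ancestor and `det2 e w` vanishes; if not, `e` is a common cause of its successor `x`
and of `w`, and a tree model gives `det3 x w ≠ 0`. -/

namespace LSEM

open Relation

/-! ### Moments of the noise and of the solution. -/

section Moments
variable {V : Type*}

namespace IsNoiseLaw
variable {μ : Measure (V → ℝ)}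

theorem integrable_mul (hμ : IsNoiseLaw μ) (i j : V) : Integrable (fun ε => ε i * ε j) μ := by
  have := hμ.isProbabilityMeasure
  have hi := (hμ.memLp i).mono_exponent (p := 2) (by norm_num)
  have hj := (hμ.memLp j).mono_exponent (p := 2) (by norm_num)
  exact hi.integrable_mul hj

theorem integrable_mul_mul (hμ : IsNoiseLaw μ) (i j k : V) :
    Integrable (fun ε => ε i * ε j * ε k) μ := by
  have hcube (l : V) : Integrable (fun ε : V → ℝ => ‖ε l‖ ^ 3) μ :=
    (hμ.memLp l).integrable_norm_pow (p := 3) (by norm_num)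
  refine (((hcube i).add (hcube j)).add (hcube k)).mono' ?_ (.of_forall fun ε => ?_)
  · exact (((measurable_pi_apply i).mul (measurable_pi_apply j)).mul
      (measurable_pi_apply k)).aestronglyMeasurable
  · simp only [norm_mul, Pi.add_apply]
    have key : ∀ a b c : ℝ, 0 ≤ a → 0 ≤ b → 0 ≤ c → a * b * c ≤ a ^ 3 + b ^ 3 + c ^ 3 := by
      intro a b c ha hb hc
      nlinarith [mul_nonneg (add_nonneg (add_nonneg ha hb) hc) (sq_nonneg (a - b)),
        mul_nonneg (add_nonneg (add_nonneg ha hb) hc) (sq_nonneg (b - c)),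
        mul_nonneg (add_nonneg (add_nonneg ha hb) hc) (sq_nonneg (a - c)),
        mul_nonneg (mul_nonneg ha hb) hc]
    exact key _ _ _ (norm_nonneg _) (norm_nonneg _) (norm_nonneg _)

theorem integral_mul_of_ne (hμ : IsNoiseLaw μ) {i j : V} (hij : i ≠ j) :
    ∫ ε, ε i * ε j ∂μ = 0 := by
  have h := (hμ.indep.indepFun hij).integral_fun_mul_eq_mul_integral
    (measurable_pi_apply i).aestronglyMeasurable (measurable_pi_apply j).aestronglyMeasurable
  rw [h, hμ.centered i, zero_mul]

theorem integral_mul_mul_of_ne (hμ : IsNoiseLaw μ) {i j k : V} (hik : i ≠ k) (hjk : j ≠ k) :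
    ∫ ε, ε i * ε j * ε k ∂μ = 0 := by
  have hind := (hμ.indep.indepFun_prodMk measurable_pi_apply i j k hik hjk).comp
    (φ := fun p : ℝ × ℝ => p.1 * p.2) (ψ := id) (by fun_prop) measurable_id
  have h := hind.integral_fun_mul_eq_mul_integral
    (by simp only [Function.comp_def]; exact (Measurable.aestronglyMeasurable (by fun_prop)))
    (by simp only [Function.comp_def, id]; exact (Measurable.aestronglyMeasurable (by fun_prop)))
  simp only [Function.comp_def, id] at h
  rw [h, hμ.centered k, mul_zero]

theorem integral_mul [DecidableEq V] (hμ : IsNoiseLaw μ) (i j : V) :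
    ∫ ε, ε i * ε j ∂μ = if i = j then ∫ ε, ε i ^ 2 ∂μ else 0 := by
  split_ifs with h
  · subst h; simp only [sq]
  · exact hμ.integral_mul_of_ne h

theorem integral_mul_mul [DecidableEq V] (hμ : IsNoiseLaw μ) (i j k : V) :
    ∫ ε, ε i * ε j * ε k ∂μ = if i = j ∧ i = k then ∫ ε, ε i ^ 3 ∂μ else 0 := by
  split_ifs with h
  · obtain ⟨rfl, rfl⟩ := h
    exact integral_congr_ae (.of_forall fun ε => by ring)
  · by_cases hik : i = k
    · subst hik
      have hij : i ≠ j := fun e => h ⟨e, rfl⟩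
      rw [← hμ.integral_mul_mul_of_ne hij hij]
      exact integral_congr_ae (.of_forall fun ε => by ring)
    · by_cases hjk : j = k
      · subst hjk
        rw [← hμ.integral_mul_mul_of_ne (Ne.symm hik) (Ne.symm hik)]
        exact integral_congr_ae (.of_forall fun ε => by ring)
      · exact hμ.integral_mul_mul_of_ne hik hjk

end IsNoiseLaw

variable [Fintype V]

/-- The law on `{a, -1/a}` with mean `0` and variance `1`. -/
noncomputable def twoPointLaw (a : ℝ) : Measure ℝ :=
  ENNReal.ofReal (1 / (a ^ 2 + 1)) • Measure.dirac a +
    ENNReal.ofReal (a ^ 2 / (a ^ 2 + 1)) • Measure.dirac (-1 / a)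

instance (a : ℝ) : IsProbabilityMeasure (twoPointLaw a) where
  measure_univ := by
    simp only [twoPointLaw, Measure.coe_add, Measure.coe_smul, Pi.add_apply, Pi.smul_apply,
      measure_univ, smul_eq_mul, mul_one]
    rw [← ENNReal.ofReal_add (by positivity) (by positivity), ← add_div, add_comm,
      div_self (by positivity), ENNReal.ofReal_one]

theorem integral_twoPointLaw (a : ℝ) (f : ℝ → ℝ) :
    ∫ x, f x ∂twoPointLaw a = 1 / (a ^ 2 + 1) * f a + a ^ 2 / (a ^ 2 + 1) * f (-1 / a) := by
  rw [twoPointLaw, integral_add_measure, integral_smul_measure, integral_smul_measure,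
    integral_dirac, integral_dirac, ENNReal.toReal_ofReal (by positivity),
    ENNReal.toReal_ofReal (by positivity), smul_eq_mul, smul_eq_mul]
  all_goals exact (integrable_dirac (by simp)).smul_measure ENNReal.ofReal_ne_top

theorem memLp_twoPointLaw (a : ℝ) : MemLp (fun x => x) 3 (twoPointLaw a) := by
  refine MemLp.of_bound measurable_id.aestronglyMeasurable (max ‖a‖ ‖-1 / a‖) ?_
  rw [twoPointLaw, ae_add_measure_iff]
  constructor <;> refine Measure.ae_smul_measure ?_ _ <;> rw [ae_dirac_eq] <;> simp [abs_div]

theorem exists_isNoiseLaw (S : Set V) [DecidablePred (· ∈ S)] :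
    ∃ μ : Measure (V → ℝ), IsNoiseLaw μ ∧ (∀ i, ∫ ε, ε i ^ 2 ∂μ = 1) ∧
      ∀ i, ∫ ε, ε i ^ 3 ∂μ = if i ∈ S then 3 / 2 else 0 := by
  -- The third moment of `twoPointLaw a` is `a - 1/a`: `3/2` at `a = 2` and `0` at `a = 1`.
  let a (i : V) : ℝ := if i ∈ S then 2 else 1
  have ha (i : V) : a i ≠ 0 := by simp only [a]; split_ifs <;> norm_num
  have hint (i : V) (f : ℝ → ℝ) (hf : Measurable f) :
      ∫ ε : V → ℝ, f (ε i) ∂Measure.pi (fun i => twoPointLaw (a i)) =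
        ∫ x, f x ∂twoPointLaw (a i) := by
    have hmp := measurePreserving_eval (fun i => twoPointLaw (a i)) i
    rw [← hmp.map_eq, integral_map hmp.measurable.aemeasurable hf.aestronglyMeasurable]
  have hsq (i : V) : ∫ ε : V → ℝ, ε i ^ 2 ∂Measure.pi (fun i => twoPointLaw (a i)) = 1 := by
    rw [hint i (fun x => x ^ 2) (by fun_prop), integral_twoPointLaw]
    have := ha i
    field_simp
  refine ⟨Measure.pi fun i => twoPointLaw (a i), ⟨inferInstance, ?_, fun i => ?_, fun i => ?_,
    fun i => by rw [hsq i]; exact one_pos⟩, hsq, fun i => ?_⟩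
  · exact iIndepFun_pi (X := fun _ x => x) fun i => aemeasurable_id
  · exact (memLp_twoPointLaw (a i)).comp_measurePreserving
      (measurePreserving_eval (fun i => twoPointLaw (a i)) i)
  · rw [hint i (fun x => x) (by fun_prop), integral_twoPointLaw]
    have := ha i
    field_simp
    ring
  · rw [hint i (fun x => x ^ 3) (by fun_prop), integral_twoPointLaw]
    simp only [a]
    split_ifs <;> norm_num

variable [DecidableEq V]

theorem solution_apply (Λ : Matrix V V ℝ) (ε : V → ℝ) (u : V) :
    solution Λ ε u = ∑ i, (1 - Λ)⁻¹ i u * ε i := by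
  simp [solution, Matrix.mulVec, dotProduct]

theorem secondMoment_eq (Λ : Matrix V V ℝ) {μ : Measure (V → ℝ)} (hμ : IsNoiseLaw μ) (u v : V) :
    secondMoment Λ μ u v =
      ∑ i, (1 - Λ)⁻¹ i u * (1 - Λ)⁻¹ i v * ∫ ε, ε i ^ 2 ∂μ := by
  have h (ε : V → ℝ) : solution Λ ε u * solution Λ ε v =
      ∑ i, ∑ j, ((1 - Λ)⁻¹ i u * (1 - Λ)⁻¹ j v) * (ε i * ε j) := by
    simp only [solution_apply, Finset.sum_mul_sum]
    exact Finset.sum_congr rfl fun i _ => Finset.sum_congr rfl fun j _ => by ring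
  simp only [secondMoment, h]
  rw [integral_finsetSum _ fun i _ => integrable_finsetSum _ fun j _ =>
    (hμ.integrable_mul i j).const_mul _]
  refine Finset.sum_congr rfl fun i _ => ?_
  rw [integral_finsetSum _ fun j _ => (hμ.integrable_mul i j).const_mul _]
  simp [integral_const_mul, hμ.integral_mul]

theorem thirdMoment_eq (Λ : Matrix V V ℝ) {μ : Measure (V → ℝ)} (hμ : IsNoiseLaw μ)
    (u v w : V) :
    thirdMoment Λ μ u v w =
      ∑ i, (1 - Λ)⁻¹ i u * (1 - Λ)⁻¹ i v * (1 - Λ)⁻¹ i w * ∫ ε, ε i ^ 3 ∂μ := by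
  have h (ε : V → ℝ) : solution Λ ε u * solution Λ ε v * solution Λ ε w =
      ∑ i, ∑ j, ∑ k, ((1 - Λ)⁻¹ i u * (1 - Λ)⁻¹ j v * (1 - Λ)⁻¹ k w) * (ε i * ε j * ε k) := by
    rw [solution_apply, solution_apply, solution_apply, Finset.sum_mul_sum, Finset.sum_mul]
    refine Finset.sum_congr rfl fun i _ => ?_
    rw [Finset.sum_mul]
    refine Finset.sum_congr rfl fun j _ => ?_
    rw [Finset.mul_sum]
    exact Finset.sum_congr rfl fun k _ => by ring
  simp only [thirdMoment, h]
  have hint (i j k : V) := (hμ.integrable_mul_mul i j k).const_mul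
    ((1 - Λ)⁻¹ i u * (1 - Λ)⁻¹ j v * (1 - Λ)⁻¹ k w)
  rw [integral_finsetSum _ fun i _ => integrable_finsetSum _ fun j _ =>
    integrable_finsetSum _ fun k _ => hint i j k]
  refine Finset.sum_congr rfl fun i _ => ?_
  rw [integral_finsetSum _ fun j _ => integrable_finsetSum _ fun k _ => hint i j k]
  rw [Finset.sum_eq_single i]
  · rw [integral_finsetSum _ fun k _ => hint i i k]
    simp [integral_const_mul, hμ.integral_mul_mul]
  · intro j _ hj
    rw [integral_finsetSum _ fun k _ => hint i j k]
    exact Finset.sum_eq_zero fun k _ => by simp [integral_const_mul, hμ.integral_mul_mul, hj.symm]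
  · simp

end Moments

variable {V : Type*}

/-! ### Root cycles, exits from them, and spanning trees. -/

section Graph

variable {G : Digraph V}

theorem exists_coe_cons_of_mem {c : Cycle V} {u : V} (hu : u ∈ c) :
    ∃ l : List V, c = ((u :: l : List V) : Cycle V) := by
  induction c using Quotient.inductionOn with
  | h l =>
    obtain ⟨s, t, rfl⟩ := List.append_of_mem (Cycle.mem_coe_iff.mp hu)
    exact ⟨t ++ s, Cycle.coe_eq_coe.mpr List.isRotated_append⟩

theorem isDirectedCycle_coe_cons {a : V} {l : List V} :
    IsDirectedCycle G ((a :: l : List V) : Cycle V) ↔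
      (a :: l).Nodup ∧ List.IsChain G.Adj (a :: (l ++ [a])) := by
  rw [IsDirectedCycle, Cycle.nodup_coe_iff, Cycle.chain_coe_cons]
  simp

theorem IsDirectedCycle.reflTransGen {c : Cycle V} (hc : IsDirectedCycle G c) {u v : V}
    (hu : u ∈ c) (hv : v ∈ c) : ReflTransGen G.Adj u v := by
  obtain ⟨l, rfl⟩ := exists_coe_cons_of_mem hu
  have hch : List.IsChain (ReflTransGen G.Adj) (u :: (l ++ [u])) :=
    (isDirectedCycle_coe_cons.mp hc).2.imp fun _ _ h => .single h
  rw [List.isChain_iff_pairwise, List.pairwise_cons] at hch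
  rcases List.mem_cons.mp (Cycle.mem_coe_iff.mp hv) with rfl | hv
  · exact .refl
  · exact hch.1 v (List.mem_append_left _ hv)

/-- On an ancestral cycle of a cycle-disjoint graph, the predecessor in the cycle is the only
parent. -/
theorem eq_of_adj_of_isRootCycle (hG : CycleDisjoint G) {x y z : V} {l : List V}
    (hc : IsDirectedCycle G ((y :: (l ++ [x]) : List V) : Cycle V))
    (hanc : IsAncestral G {v | v ∈ ((y :: (l ++ [x]) : List V) : Cycle V)}) (hz : G.Adj z y) :
    z = x := by
  have hmem : z ∈ ((y :: (l ++ [x]) : List V) : Cycle V) := by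
    change z ∈ {v | v ∈ ((y :: (l ++ [x]) : List V) : Cycle V)}
    rw [← hanc]
    exact ⟨y, by simp, .single hz⟩
  -- All cycles through `y` have the same length, so a parent of `y` other than `x` would close a
  -- cycle that is too short.
  have huniq (l' : List V) (hl' : IsDirectedCycle G ((y :: l' : List V) : Cycle V)) :
      l'.length = l.length + 1 := by
    have := hG y _ _ hc hl' (by simp) (by simp)
    simpa using (Cycle.coe_eq_coe.mp this).perm.length_eq.symm
  obtain ⟨hnd, hch⟩ := isDirectedCycle_coe_cons.mp hc
  rw [Cycle.mem_coe_iff, List.mem_cons, List.mem_append, List.mem_singleton] at hmem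
  rcases hmem with rfl | hzl | rfl
  · have := huniq [] (isDirectedCycle_coe_cons.mpr ⟨by simp, by simpa using hz⟩)
    simp at this
  · obtain ⟨s, t, rfl⟩ := List.append_of_mem hzl
    have := huniq (s ++ [z]) (isDirectedCycle_coe_cons.mpr ⟨?_, ?_⟩)
    · simp at this
    · refine hnd.sublist (List.Sublist.cons_cons _ ?_)
      simp
    · have h1 : List.IsChain G.Adj ((y :: s) ++ z :: (t ++ [x] ++ [y])) := by simpa using hch
      rw [List.isChain_split] at h1
      simpa using List.isChain_append_cons_cons.mpr ⟨h1.1, hz, List.isChain_singleton y⟩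
  · rfl

theorem isChain_of_forall_append {r : V → V → Prop} {l : List V}
    (h : ∀ s t x y, l = s ++ x :: y :: t → r x y) : List.IsChain r l := by
  rw [List.isChain_iff_getElem]
  intro n hn
  refine h (l.take n) (l.drop (n + 2)) _ _ ?_
  rw [← List.drop_eq_getElem_cons (by omega), ← List.drop_eq_getElem_cons (by omega),
    List.take_append_drop]

/-- Each consecutive pair `x, y` on the arc becomes last and first after a rotation, where
`eq_of_adj_of_isRootCycle` applies. -/
theorem isChain_unique_parent (hG : CycleDisjoint G) {c : Cycle V} (hc : IsDirectedCycle G c)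
    (hanc : IsAncestral G {v | v ∈ c}) {u v : V} {l₁ l₂ : List V}
    (hl : c = ((u :: (l₁ ++ v :: l₂) : List V) : Cycle V)) :
    List.IsChain (fun x y => ∀ z, G.Adj z y → z = x) (u :: (l₁ ++ [v])) := by
  refine isChain_of_forall_append fun s t x y hst z hz => ?_
  have hl' : c = ((y :: (t ++ l₂ ++ s ++ [x]) : List V) : Cycle V) := by
    have : u :: (l₁ ++ v :: l₂) = (s ++ [x]) ++ (y :: t ++ l₂) := by
      simpa using congrArg (· ++ l₂) hst
    rw [hl, this, Cycle.coe_eq_coe]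
    simpa using List.isRotated_append (l := s ++ [x]) (l' := y :: t ++ l₂)
  subst hl'
  exact eq_of_adj_of_isRootCycle hG hc hanc hz

/-- `c` is the last node of `C` on the path; the rest of the path stays outside `C`. -/
theorem exists_exit {C : Set V} {u w : V} (hu : u ∈ C) (h : ReflTransGen G.Adj u w) :
    ∃ c ∈ C, ReflTransGen (fun x y => G.Adj x y ∧ (x = c ∨ x ∉ C) ∧ y ∉ C) c w := by
  induction h with
  | refl => exact ⟨u, hu, .refl⟩
  | @tail x y _ hxy ih =>
    by_cases hy : y ∈ C
    · exact ⟨y, hy, .refl⟩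
    · obtain ⟨c, hc, hcx⟩ := ih
      refine ⟨c, hc, hcx.tail ⟨hxy, ?_, hy⟩⟩
      rcases hcx.cases_tail with h | ⟨z, -, -, -, hx⟩
      exacts [.inl h, .inr hx]

/-- Breadth-first search from `r`: `d` is the distance and `p` the tree parent. -/
theorem exists_depth_parent (R : V → V → Prop) (r : V) :
    ∃ (d : V → ℕ) (p : V → V), ∀ w, ReflTransGen R r w → w ≠ r →
      ReflTransGen R r (p w) ∧ R (p w) w ∧ d (p w) < d w := by
  classical
  let reach : ℕ → V → Prop := fun n => Nat.rec (fun w => w = r) (fun _ P w => ∃ p, P p ∧ R p w) n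
  have hsound (n : ℕ) (w : V) (h : reach n w) : ReflTransGen R r w := by
    induction n generalizing w with
    | zero => obtain rfl : w = r := h; exact .refl
    | succ n ih => obtain ⟨p, hp, hpw⟩ := h; exact (ih p hp).tail hpw
  have hcomplete (w : V) (h : ReflTransGen R r w) : ∃ n, reach n w := by
    induction h with
    | refl => exact ⟨0, rfl⟩
    | tail _ h ih => obtain ⟨n, hn⟩ := ih; exact ⟨n + 1, _, hn, h⟩
  let d (w : V) : ℕ := sInf {n | reach n w}
  have hp (w : V) : ∃ p, ReflTransGen R r w → w ≠ r →
      ReflTransGen R r p ∧ R p w ∧ d p < d w := by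
    by_cases h : ReflTransGen R r w ∧ w ≠ r
    · have hd : reach (d w) w := Nat.sInf_mem (hcomplete w h.1)
      cases hdw : d w with
      | zero => rw [hdw] at hd; exact absurd hd h.2
      | succ n =>
        rw [hdw] at hd
        obtain ⟨p, hp, hpw⟩ := hd
        exact ⟨p, fun _ _ => ⟨hsound n p hp, hpw, Nat.lt_succ_of_le (Nat.sInf_le hp)⟩⟩
    · exact ⟨w, fun h1 h2 => absurd ⟨h1, h2⟩ h⟩
  choose p hp using hp
  exact ⟨d, p, hp⟩

end Graph

/-! ### The inverse of `I - Λ` -/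

variable [Fintype V] [DecidableEq V] {Λ : Matrix V V ℝ}

theorem inv_apply (hΛ : IsUnit (1 - Λ)) (i j : V) :
    (1 - Λ)⁻¹ i j = (if i = j then 1 else 0) + ∑ k, (1 - Λ)⁻¹ i k * Λ k j := by
  have h : (1 - Λ)⁻¹ * (1 - Λ) = 1 :=
    Matrix.nonsing_inv_mul _ ((Matrix.isUnit_iff_isUnit_det _).mp hΛ)
  rw [mul_sub, mul_one, sub_eq_iff_eq_add] at h
  calc (1 - Λ)⁻¹ i j = (1 + (1 - Λ)⁻¹ * Λ) i j := by rw [← h]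
    _ = _ := by rw [Matrix.add_apply, Matrix.one_apply, Matrix.mul_apply]

/-- No edge leaves the set reachable from `i`, so `1 - Λ` is block triangular, and so is its
inverse. This needs no convergence of `∑ Λⁿ`, which may fail in the presence of cycles. -/
theorem reflTransGen_of_inv_apply_ne_zero (hΛ : IsUnit (1 - Λ)) {R : V → V → Prop}
    (hR : ∀ i j, Λ i j ≠ 0 → R i j) {i j : V} (h : (1 - Λ)⁻¹ i j ≠ 0) : ReflTransGen R i j := by
  classical
  by_contra hij
  have := hΛ.invertible
  let b (k : V) : ℕ := if ReflTransGen R i k then 1 else 0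
  have hb : (1 - Λ).BlockTriangular b := by
    intro k l hkl
    have hk : ReflTransGen R i k := by
      by_contra hk; simp [b, hk] at hkl
    have hl : ¬ ReflTransGen R i l := by
      intro hl; simp [b, hk, hl] at hkl
    have hne : k ≠ l := by rintro rfl; exact hl hk
    have h0 : Λ k l = 0 := by
      by_contra h0; exact hl (hk.tail (hR k l h0))
    simp [h0, hne]
  refine h (Matrix.blockTriangular_inv_of_blockTriangular hb ?_)
  simp [b, hij, ReflTransGen.refl]

/-- A chain of nodes with unique parents propagates proportionality of columns. -/
theorem exists_forall_inv_apply_eq_mul (hΛ : IsUnit (1 - Λ)) {l : List V} {u v : V}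
    (h : List.IsChain (fun x y => ∀ z, Λ z y ≠ 0 → z = x) (u :: (l ++ [v]))) :
    ∃ β : ℝ, ∀ i ∉ l ++ [v], (1 - Λ)⁻¹ i v = β * (1 - Λ)⁻¹ i u := by
  have hstep {x y : V} (hxy : ∀ z, Λ z y ≠ 0 → z = x) {i : V} (hi : i ≠ y) :
      (1 - Λ)⁻¹ i y = (1 - Λ)⁻¹ i x * Λ x y := by
    rw [inv_apply hΛ, if_neg hi, zero_add]
    refine Finset.sum_eq_single x (fun z _ hz => ?_) (by simp)
    rw [not_imp_comm.mp (hxy z) hz, mul_zero]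
  induction l generalizing u with
  | nil =>
    refine ⟨Λ u v, fun i hi => ?_⟩
    rw [hstep (by simpa using h) (by simpa using hi), mul_comm]
  | cons x l ih =>
    rw [List.cons_append, List.isChain_cons_cons] at h
    obtain ⟨β, hβ⟩ := ih h.2
    refine ⟨β * Λ u x, fun i hi => ?_⟩
    rw [List.cons_append, List.mem_cons, not_or] at hi
    rw [hβ i hi.2, hstep h.1 hi.1]
    ring

/-- The coefficient matrix of a spanning tree, with unit weights, of the nodes reachable from
`r`. -/
theorem exists_tree_matrix (R : V → V → Prop) (r : V) :
    ∃ Λ : Matrix V V ℝ, IsUnit (1 - Λ) ∧ (∀ i j, Λ i j ≠ 0 → R i j) ∧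
      (∀ i, (1 - Λ)⁻¹ i r = if i = r then 1 else 0) ∧
      (∀ w, ReflTransGen R r w → (1 - Λ)⁻¹ r w = 1) ∧ ∀ w, (1 - Λ)⁻¹ w w = 1 := by
  classical
  obtain ⟨d, p, hp⟩ := exists_depth_parent R r
  let Λ : Matrix V V ℝ := fun i j => if (ReflTransGen R r j ∧ j ≠ r) ∧ i = p j then 1 else 0
  have hsupp (i j : V) (h : Λ i j ≠ 0) : (ReflTransGen R r j ∧ j ≠ r) ∧ i = p j := by
    by_contra h'; exact h (if_neg h')
  have hcol (x : V → ℝ) (w : V) : ∑ k, x k * Λ k w =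
      if ReflTransGen R r w ∧ w ≠ r then x (p w) else 0 := by
    split_ifs with hw <;> simp [Λ, hw]
  have hΛ : IsUnit (1 - Λ) := by
    -- A left kernel vector takes at each non-root tree node the value of its parent and is `0`
    -- elsewhere; induction on depth kills it.
    rw [← Matrix.vecMul_injective_iff_isUnit]
    refine (injective_iff_map_eq_zero (Matrix.vecMulLinear (1 - Λ))).mpr fun x hx => ?_
    have hx' (w : V) : x w = if ReflTransGen R r w ∧ w ≠ r then x (p w) else 0 := by
      have := congrFun hx w
      rw [Matrix.vecMulLinear_apply, Matrix.vecMul_sub, Matrix.vecMul_one, Pi.sub_apply,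
        Pi.zero_apply, sub_eq_zero] at this
      rw [this, ← hcol]
      rfl
    have (n : ℕ) (w : V) (hw : d w = n) : x w = 0 := by
      induction n using Nat.strong_induction_on generalizing w with
      | _ n ih =>
        rw [hx']
        split_ifs with h
        · exact ih _ (hw ▸ (hp w h.1 h.2).2.2) _ rfl
        · rfl
    exact funext fun w => this _ w rfl
  have hinv (i w : V) : (1 - Λ)⁻¹ i w = (if i = w then 1 else 0) +
      if ReflTransGen R r w ∧ w ≠ r then (1 - Λ)⁻¹ i (p w) else 0 := by
    rw [inv_apply hΛ, hcol]
  refine ⟨Λ, hΛ, fun i j h => ?_, fun i => ?_, fun w hw => ?_, fun w => ?_⟩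
  · obtain ⟨h1, rfl⟩ := hsupp i j h
    exact (hp j h1.1 h1.2).2.1
  · rw [hinv]; simp
  · generalize hn : d w = n
    induction n using Nat.strong_induction_on generalizing w with
    | _ n ih =>
      rw [hinv]
      by_cases hwr : w = r
      · simp [hwr]
      · obtain ⟨h1, -, h3⟩ := hp w hw hwr
        rw [if_neg (Ne.symm hwr), if_pos ⟨hw, hwr⟩, ih _ (hn ▸ h3) _ h1 rfl, zero_add]
  · rw [hinv, if_pos rfl, add_eq_left, ite_eq_right_iff]
    intro hw
    -- A nonzero entry would give a path from `w` to its parent, yet depth never decreases along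
    -- edges of `Λ`.
    by_contra hne
    have hle : d w ≤ d (p w) := by
      have := reflTransGen_of_inv_apply_ne_zero hΛ (R := fun i j => d i ≤ d j) (fun i j h => ?_) hne
      · rwa [reflTransGen_eq_self] at this
      · obtain ⟨h1, rfl⟩ := hsupp i j h
        exact (hp j h1.1 h1.2).2.2.le
    exact absurd (hp w hw.1 hw.2).2.2 hle.not_gt

/-! ### Vanishing and nonvanishing determinants -/

variable {G : Digraph V} {μ : Measure (V → ℝ)}

theorem adj_of_ne_zero (hΛ : Λ ∈ coefficientMatrices G) (i j : V) (h : Λ i j ≠ 0) : G.Adj i j :=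
  not_imp_comm.mp (hΛ.2 i j) h

theorem det2_eq_zero_of_forall_mul_eq_zero (hμ : IsNoiseLaw μ) {u v : V}
    (h : ∀ i, (1 - Λ)⁻¹ i u * (1 - Λ)⁻¹ i v = 0) : det2 u v Λ μ = 0 := by
  simp [det2, Matrix.det_fin_two, secondMoment_eq Λ hμ, thirdMoment_eq Λ hμ, mul_assoc _ _
    ((1 - Λ)⁻¹ _ v), h]

/-- Both rows are multiples of `(B_uu, B_uv)`, as `ε u` is the only noise entering `X_u`. -/
theorem det2_eq_zero_of_forall_ne (hμ : IsNoiseLaw μ) {u v : V}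
    (h : ∀ i, i ≠ u → (1 - Λ)⁻¹ i u = 0) : det2 u v Λ μ = 0 := by
  have hs (w : V) : secondMoment Λ μ u w =
      (1 - Λ)⁻¹ u u * (1 - Λ)⁻¹ u w * ∫ ε, ε u ^ 2 ∂μ := by
    rw [secondMoment_eq Λ hμ]
    exact Finset.sum_eq_single u (fun i _ hi => by simp [h i hi]) (by simp)
  have ht (w : V) : thirdMoment Λ μ u u w =
      (1 - Λ)⁻¹ u u * (1 - Λ)⁻¹ u u * (1 - Λ)⁻¹ u w * ∫ ε, ε u ^ 3 ∂μ := by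
    rw [thirdMoment_eq Λ hμ]
    exact Finset.sum_eq_single u (fun i _ hi => by simp [h i hi]) (by simp)
  simp only [det2, Matrix.det_fin_two_of, hs, ht]
  ring

theorem det3_eq_zero (hμ : IsNoiseLaw μ) {u v : V} {α β : ℝ}
    (h : ∀ i, (1 - Λ)⁻¹ i v = β * (1 - Λ)⁻¹ i u ∨ (1 - Λ)⁻¹ i u = α * (1 - Λ)⁻¹ i v) :
    det3 u v Λ μ = 0 := by
  have hpoly (i : V) : -β * ((1 - Λ)⁻¹ i u * (1 - Λ)⁻¹ i u) +
      (1 + α * β) * ((1 - Λ)⁻¹ i u * (1 - Λ)⁻¹ i v) -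
      α * ((1 - Λ)⁻¹ i v * (1 - Λ)⁻¹ i v) = 0 := by
    rcases h i with h | h <;> rw [h] <;> ring
  have hsum (f : V → ℝ) : -β * ∑ i, (1 - Λ)⁻¹ i u * (1 - Λ)⁻¹ i u * f i +
      (1 + α * β) * ∑ i, (1 - Λ)⁻¹ i u * (1 - Λ)⁻¹ i v * f i -
      α * ∑ i, (1 - Λ)⁻¹ i v * (1 - Λ)⁻¹ i v * f i = 0 := by
    rw [Finset.mul_sum, Finset.mul_sum, Finset.mul_sum, ← Finset.sum_add_distrib,
      ← Finset.sum_sub_distrib]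
    exact Finset.sum_eq_zero fun i _ => by linear_combination f i * hpoly i
  rw [det3, ← Matrix.exists_mulVec_eq_zero_iff]
  -- The coefficients of `(b_v - β b_u)(b_u - α b_v)`; the middle one is `1` when `β = 0`.
  refine ⟨![-β, 1 + α * β, -α], fun h0 => ?_, ?_⟩
  · have h1 := congrFun h0 0
    have h2 := congrFun h0 1
    simp only [Matrix.cons_val_zero, Matrix.cons_val_one, Pi.zero_apply, neg_eq_zero] at h1 h2
    simp [h1] at h2
  · have e1 := hsum fun i => ∫ ε, ε i ^ 2 ∂μ
    have e2 := hsum fun i => (1 - Λ)⁻¹ i u * ∫ ε, ε i ^ 3 ∂μ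
    have e3 := hsum fun i => (1 - Λ)⁻¹ i v * ∫ ε, ε i ^ 3 ∂μ
    have t1 : thirdMoment Λ μ v v u = thirdMoment Λ μ u v v := by
      exact integral_congr_ae (.of_forall fun ε => by ring)
    have t2 : thirdMoment Λ μ u v u = thirdMoment Λ μ u u v := by
      exact integral_congr_ae (.of_forall fun ε => by ring)
    simp only [← mul_assoc] at e2 e3
    simp only [← secondMoment_eq Λ hμ, ← thirdMoment_eq Λ hμ] at e1 e2 e3
    rw [t1, t2] at e2
    ext k
    fin_cases k <;> simp [Matrix.mulVec, dotProduct, Fin.sum_univ_three] <;> linarith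

/-- In a unit-weight tree rooted at `v` with only `ε v` skewed, `t_uuu = t_uuv = 3/2` and `s_uv =
1`, whereas `s_uu ≥ 2` because `ε u` contributes too. -/
theorem not_vanishesIdentically_det2 {u v : V} (huv : u ≠ v) (h : ReflTransGen G.Adj v u) :
    ¬ VanishesIdentically G (det2 u v) := by
  classical
  intro hvan
  obtain ⟨Λ, hΛ, hadj, hv, hreach, hdiag⟩ := exists_tree_matrix G.Adj v
  obtain ⟨μ, hμ, h2, h3⟩ := exists_isNoiseLaw ({v} : Set V)
  have h0 := hvan Λ ⟨hΛ, fun i j hij => not_imp_comm.mp (hadj i j) hij⟩ μ hμ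
  have hu : 2 ≤ secondMoment Λ μ u u := by
    rw [secondMoment_eq Λ hμ]
    calc (2 : ℝ) = ∑ i ∈ {u, v}, (1 - Λ)⁻¹ i u * (1 - Λ)⁻¹ i u * ∫ ε, ε i ^ 2 ∂μ := by
          rw [Finset.sum_pair huv, hdiag, hreach u h, h2, h2]; norm_num
      _ ≤ _ := Finset.sum_le_univ_sum_of_nonneg fun i => by
          rw [h2, mul_one]; exact mul_self_nonneg _
  have h1 : secondMoment Λ μ u v = 1 := by
    simp [secondMoment_eq Λ hμ, hv, h2, hreach u h]
  have ht (w : V) (hw : (1 - Λ)⁻¹ v w = 1) : thirdMoment Λ μ u u w = 3 / 2 := by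
    simp [thirdMoment_eq Λ hμ, h3, hreach u h, hw]
  rw [det2, Matrix.det_fin_two_of, h1, ht u (hreach u h), ht v (hdiag v)] at h0
  linarith

/-- Take a tree rooted at the common cause `c`, with only `ε u` and `ε w` skewed. Neither of `u, w`
affects the other, so the mixed third moments vanish and the determinant is `-s_uw (3/2)²`, with
`s_uw = 1` coming from `c`. -/
theorem not_vanishesIdentically_det3 {c u w : V} (hcu : c ≠ u) (hcw : c ≠ w) (huw : u ≠ w) (hadj : G.Adj c u)
    {R : V → V → Prop} (hRG : ∀ x y, R x y → G.Adj x y) (hRu : ∀ x y, R x y → x ≠ u ∧ y ≠ u)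
    (hw : ReflTransGen R c w) : ¬ VanishesIdentically G (det3 u w) := by
  classical
  intro hvan
  let R' (x y : V) : Prop := R x y ∨ x = c ∧ y = u
  have hR'u (y : V) : ¬ R' u y := by
    rintro (h | h)
    · exact (hRu u y h).1 rfl
    · exact hcu h.1.symm
  have hRu' (x : V) (h : R' x u) : x = c := by
    rcases h with h | h
    · exact absurd rfl (hRu x u h).2
    · exact h.1
  obtain ⟨Λ, hΛ, hR, hc, hreach, hdiag⟩ := exists_tree_matrix R' c
  obtain ⟨μ, hμ, h2, h3⟩ := exists_isNoiseLaw ({u, w} : Set V)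
  have h0 := hvan Λ ⟨hΛ, fun i j hij => not_imp_comm.mp (fun h => by
    rcases hR i j h with h | ⟨rfl, rfl⟩
    exacts [hRG i j h, hadj]) hij⟩ μ hμ
  have hcw1 : (1 - Λ)⁻¹ c w = 1 := hreach w (ReflTransGen.mono (fun x y h => .inl h) _ _ hw)
  have hcu1 : (1 - Λ)⁻¹ c u = 1 := hreach u (.single (.inr ⟨rfl, rfl⟩))
  have huw0 : (1 - Λ)⁻¹ u w = 0 := by
    by_contra h
    rcases (reflTransGen_of_inv_apply_ne_zero hΛ hR h).cases_head with h | ⟨y, h, -⟩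
    exacts [huw h, hR'u y h]
  -- The only parent of `u` in `R'` is the root `c`, so `X_u` involves only `ε c` and `ε u`.
  have hcolu (i : V) (hic : i ≠ c) (hiu : i ≠ u) : (1 - Λ)⁻¹ i u = 0 := by
    rw [inv_apply hΛ, if_neg hiu, zero_add]
    refine Finset.sum_eq_zero fun k _ => ?_
    by_cases hk : k = c
    · rw [hk, hc, if_neg hic, zero_mul]
    · rw [not_imp_comm.mp (fun h => hRu' k (hR k u h)) hk, mul_zero]
  have hsum (f : V → ℝ) (hf : ∀ i, (1 - Λ)⁻¹ i u = 0 → f i = 0) : ∑ i, f i = f c + f u := by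
    rw [← Finset.sum_pair hcu]
    refine (Finset.sum_subset (Finset.subset_univ _) fun i _ hi => hf i ?_).symm
    simp only [Finset.mem_insert, Finset.mem_singleton, not_or] at hi
    exact hcolu i hi.1 hi.2
  have hwu : (1 - Λ)⁻¹ w u = 0 := hcolu w hcw.symm huw.symm
  have hT (a b d : V) : thirdMoment Λ μ a b d =
      ((1 - Λ)⁻¹ u a * (1 - Λ)⁻¹ u b * (1 - Λ)⁻¹ u d +
        (1 - Λ)⁻¹ w a * (1 - Λ)⁻¹ w b * (1 - Λ)⁻¹ w d) * (3 / 2) := by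
    rw [thirdMoment_eq Λ hμ, add_mul, ← Finset.sum_pair huw
      (f := fun i => (1 - Λ)⁻¹ i a * (1 - Λ)⁻¹ i b * (1 - Λ)⁻¹ i d * (3 / 2))]
    rw [← Finset.sum_subset (Finset.subset_univ {u, w})]
    · refine Finset.sum_congr rfl fun i hi => ?_
      rw [h3, if_pos (by simpa using hi)]
    · intro i _ hi
      rw [h3, if_neg (by simpa using hi), mul_zero]
  have hsuw : secondMoment Λ μ u w = 1 := by
    rw [secondMoment_eq Λ hμ, hsum _ fun i hi => by rw [hi]; ring]
    simp [h2, hcw1, hcu1, huw0]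
  simp [det3, Matrix.det_fin_three, hT, hsuw, hdiag, hwu, huw0] at h0

/-! ### Root cycles satisfy the condition and are maximal. -/

theorem candidate_of_mem_rootCycle (hG : CycleDisjoint G) {c : Cycle V}
    (hc : IsDirectedCycle G c) (hanc : IsAncestral G {v | v ∈ c}) {u v : V} (hu : u ∈ c)
    (hv : v ∈ c) (huv : u ≠ v) :
    VanishesIdentically G (det3 u v) ∧ ¬ VanishesIdentically G (det2 u v) := by
  refine ⟨fun Λ hΛ μ hμ => ?_, not_vanishesIdentically_det2 huv (hc.reflTransGen hv hu)⟩
  obtain ⟨l, hl⟩ := exists_coe_cons_of_mem hu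
  have hvl : v ∈ l := by
    rw [hl, Cycle.mem_coe_iff, List.mem_cons] at hv
    exact hv.resolve_left huv.symm
  obtain ⟨l₁, l₂, rfl⟩ := List.append_of_mem hvl
  have hl' : c = ((v :: (l₂ ++ u :: l₁) : List V) : Cycle V) := by
    rw [hl, Cycle.coe_eq_coe]
    exact List.isRotated_append (l := u :: l₁) (l' := v :: l₂)
  have himp (x y : V) (h : ∀ z, G.Adj z y → z = x) (z : V) (hz : Λ z y ≠ 0) : z = x :=
    h z (adj_of_ne_zero hΛ z y hz)
  obtain ⟨β, hβ⟩ := exists_forall_inv_apply_eq_mul hΛ.1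
    ((isChain_unique_parent hG hc hanc hl).imp himp)
  obtain ⟨α, hα⟩ := exists_forall_inv_apply_eq_mul hΛ.1
    ((isChain_unique_parent hG hc hanc hl').imp himp)
  have hnd : (u :: (l₁ ++ v :: l₂)).Nodup := by
    rw [← Cycle.nodup_coe_iff, ← hl]; exact hc.2.1
  refine det3_eq_zero hμ (α := α) (β := β) fun i => ?_
  -- The arcs `(u, v]` and `(v, u]` are disjoint, so `i` avoids at least one of them.
  by_cases hi : i ∈ l₁ ++ [v]
  · refine .inr (hα i fun hi' => ?_)
    have hdis : List.Disjoint (l₁ ++ [v]) (l₂ ++ [u]) := by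
      refine List.disjoint_of_nodup_append (hnd.perm ?_)
      refine (List.perm_append_singleton u (l₁ ++ v :: l₂)).symm.trans ?_
      simp
    exact hdis hi hi'
  · exact .inl (hβ i hi)

/-- Every node outside a root cycle fails the candidate condition against some node of it. -/
theorem exists_mem_rootCycle_not_candidate {c : Cycle V} (hc : IsDirectedCycle G c)
    (hanc : IsAncestral G {v | v ∈ c}) {w : V} (hw : w ∉ c) :
    ∃ u ∈ c, VanishesIdentically G (det2 u w) ∨ ¬ VanishesIdentically G (det3 u w) := by
  obtain ⟨u, hu⟩ : ∃ u, u ∈ c := by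
    obtain ⟨u, hu⟩ := Multiset.exists_mem_of_ne_zero
      (mt Cycle.toMultiset_eq_nil.mp hc.1)
    exact ⟨u, by induction c using Quotient.inductionOn; simpa using hu⟩
  have hclosed {x y : V} (h : ReflTransGen G.Adj x y) (hy : y ∈ c) : x ∈ c := by
    change x ∈ {v | v ∈ c}
    rw [← hanc]
    exact ⟨y, hy, h⟩
  by_cases huw : ReflTransGen G.Adj u w
  · obtain ⟨e, he, hew⟩ := exists_exit (C := {v | v ∈ c}) hu huw
    obtain ⟨l, hl⟩ := exists_coe_cons_of_mem he
    cases l with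
    | nil =>
      refine ⟨e, he, .inl fun Λ hΛ μ hμ => det2_eq_zero_of_forall_ne hμ fun i hi => ?_⟩
      by_contra h
      have := hclosed (reflTransGen_of_inv_apply_ne_zero hΛ.1 (adj_of_ne_zero hΛ) h) he
      rw [hl, Cycle.mem_coe_iff, List.mem_singleton] at this
      exact hi this
    | cons x l =>
      have hx : x ∈ c := by rw [hl]; simp
      have hcyc := hc
      rw [hl, isDirectedCycle_coe_cons] at hcyc
      have hex : e ≠ x := by rintro rfl; simp at hcyc
      have hadj : G.Adj e x := (List.isChain_cons_cons.mp hcyc.2).1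
      refine ⟨x, hx, .inr (not_vanishesIdentically_det3 hex (by rintro rfl; exact hw he)
        (by rintro rfl; exact hw hx) hadj
        -- The path from `e` to `w` meets the cycle only at `e`, so it avoids the successor `x`.
        (fun _ _ h => h.1) (fun y z h => ⟨?_, ?_⟩) hew)⟩
      · rintro rfl
        rcases h.2.1 with h | h
        exacts [hex h.symm, h hx]
      · rintro rfl
        exact h.2.2 hx
  -- A common ancestor of `u` and `w` would lie on the cycle, hence `u` would reach `w`.
  · refine ⟨u, hu, .inl fun Λ hΛ μ hμ => det2_eq_zero_of_forall_mul_eq_zero hμ fun i => ?_⟩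
    by_contra h
    obtain ⟨h1, h2⟩ := mul_ne_zero_iff.mp h
    have hi := reflTransGen_of_inv_apply_ne_zero hΛ.1 (adj_of_ne_zero hΛ) h1
    exact huw ((hc.reflTransGen hu (hclosed hi hu)).trans
      (reflTransGen_of_inv_apply_ne_zero hΛ.1 (adj_of_ne_zero hΛ) h2))

end LSEM

theorem mainTheorem9 {V : Type*} [Fintype V] [DecidableEq V] (G : Digraph V)
    (hG : LSEM.CycleDisjoint G) (C : Set V) (hC : LSEM.IsRootCycle G C) :
    C ∈ LSEM.candidateCycles G := by
  obtain ⟨⟨c, hc, rfl⟩, hanc⟩ := hC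
  refine ⟨fun u hu v hv huv => LSEM.candidate_of_mem_rootCycle hG hc hanc hu hv huv,
    fun D hD hCD w hw => ?_⟩
  by_contra hwc
  obtain ⟨u, hu, h⟩ := LSEM.exists_mem_rootCycle_not_candidate hc hanc hwc
  have huw : u ≠ w := by rintro rfl; exact hwc hu
  obtain ⟨h3, h2⟩ := hD u (hCD hu) w hw huw
  exact h.elim h2 (not_not_intro h3)
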